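/- Let $X$ be a topological vector space over $\mathbb{K}\in\{\mathbb{R},\mathbb{C}\}$ and let $T:X\to X$ be a continuous linear operator. A *Furstenberg family* is a non-empty family $\mathcal{F}$ of subsets of $\mathbb{N}_0$ with $\varnothing\notin\mathcal{F}$ such that $A\in\mathcal{F}$ and $A\subset B\subset\mathbb{N}_0$ imply $B\in\mathcal{F}$. It is *right-invariant* if $A\in\mathcal{F}$ and $n\ge 0$ imply $A+n=\{k+n:k\in A\}\in\mathcal{F}$, and it has *CuSP* (the cut-shift-and-paste property) if for all $q\ge 1$, all $I_1,\dots,I_q\subset\mathbb{N}_0$ with $\bigcup_{j=1}^q I_j=\mathbb{N}_0$ and all $n_1,\dots,n_q\in\mathbb{N}_0$, $$A\in\mathcal{F}\ \Longrightarrow\ \bigcup_{j=1}^q\big(n_j+(A\cap I_j)\big)\in\mathcal{F}.$$ A vector $x\in X$ is *$\mathcal{F}$-hypercyclic* for $T$ if $\{n\ge 0: T^nx\in V\}\in\mathcal{F}$ for every non-empty open set $V\subset X$, and $T$ is *$\mathcal{F}$-hypercyclic* if it has an $\mathcal{F}$-hypercyclic vector. Let $\mathcal{F}$ be a right-invariant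 Furstenberg family with CuSP. (a) Let $p\ge 1$, and assume that, for every $A\subset\mathbb{N}_0$, $A\in\mathcal{F}$ if and only if $pA=\{pn:n\in A\}\in\mathcal{F}$. Then $T$ and $T^p$ have the same $\mathcal{F}$-hypercyclic vectors. In particular, if $T$ is $\mathcal{F}$-hypercyclic, then so is $T^p$. (b) Let $\lambda\in\mathbb{K}$ with $|\lambda|=1$. Then $T$ and $\lambda T$ have the same $\mathcal{F}$-hypercyclic vectors. In particular, if $T$ is $\mathcal{F}$-hypercyclic, then so is $\lambda T$. -/

import Mathlib

namespace FHyp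

/-- A Furstenberg family: a non-empty, upward closed family of subsets of `ℕ = {0, 1, 2, …}`
that does not contain the empty set. -/
structure IsFurstenbergFamily (F : Set (Set ℕ)) : Prop where
  nonempty : F.Nonempty
  mono : ∀ A ∈ F, ∀ B : Set ℕ, A ⊆ B → B ∈ F
  empty_notMem : ∅ ∉ F

/-- Right-invariance: `A ∈ F` implies `A + n ∈ F` for every `n ≥ 0`. -/
def IsRightInvariant (F : Set (Set ℕ)) : Prop :=
  ∀ A ∈ F, ∀ n : ℕ, (fun k => k + n) '' A ∈ F

/-- The cut-shift-and-paste property: whenever `ℕ = I₁ ∪ … ∪ I_q` (`q ≥ 1`) and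
`n₁, …, n_q ∈ ℕ`, then `A ∈ F` implies `⋃ⱼ (nⱼ + A ∩ Iⱼ) ∈ F`. -/
def HasCuSP (F : Set (Set ℕ)) : Prop :=
  ∀ q : ℕ, 1 ≤ q → ∀ (I : Fin q → Set ℕ) (n : Fin q → ℕ), (⋃ j, I j) = Set.univ →
    ∀ A ∈ F, (⋃ j, (fun k => n j + k) '' (A ∩ I j)) ∈ F

section

variable {𝕜 X : Type*} [RCLike 𝕜] [AddCommGroup X] [Module 𝕜 X] [TopologicalSpace X]

/-- The return set `N(x, U) = {n ≥ 0 : Tⁿ x ∈ U}`. -/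
def returnSet (T : X →L[𝕜] X) (x : X) (U : Set X) : Set ℕ :=
  {n | (T ^ n) x ∈ U}

/-- `x` is an `F`-hypercyclic vector for `T`: `N(x, V) ∈ F` for every non-empty open `V`. -/
def IsFHypercyclicVector (F : Set (Set ℕ)) (T : X →L[𝕜] X) (x : X) : Prop :=
  ∀ V : Set X, IsOpen V → V.Nonempty → returnSet T x V ∈ F

/-- `T` is `F`-hypercyclic: it admits an `F`-hypercyclic vector. -/
def IsFHypercyclic (F : Set (Set ℕ)) (T : X →L[𝕜] X) : Prop :=
  ∃ x, IsFHypercyclicVector F T x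

end

end FHyp

/-! Let `x` be hypercyclic and `U` open. CuSP lets the times in a return set be cut into finitely
many pieces and each piece be shifted by its own amount. For `T ^ p`, the times congruent to `j` mod
`p` are shifted by some `n j ≡ -j` with `T ^ n j x ∈ U`. For `c • T`, the times `k` with `c ^ k`
near `μ` are shifted by some `n` with `μ c ^ n T ^ n x ∈ U`. Finitely many `μ` suffice by
compactness of the sphere.

Such shifts exist because `(x, g)` lies in the closure of the orbit of `(x, 1)` under `T` and
multiplication by `g`, for every `g` in the circle (`mem_jointStabilizer_of_denseRange`). Otherwise
the stabilizer of `x` is a group of `m`-th roots of unity, and taking `m`-th powers yields a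
continuous circle-valued `f` on the vectors with dense orbit, with `f (T y) = χ * f y` and `χ ≠ 1`.
Since `p(T) x` has dense orbit for every polynomial `p ≠ 0`, `f` is defined along the segments
joining the `T ^ k x` and has a continuous angle there. Each segment from `T ^ k x` to `T ^ (k + 1)
x` adds the same angle `α ≠ 0`, for a total of `n * α`; but when `T ^ n x` is close to `x` the
direct segment gives a total below `π / 2`. This is impossible for large `n`. -/

namespace FHyp
open Polynomial Topology Filter

/-! ### No dense orbits in finite dimension -/

section DenseRange

variable {Q : Type*} [AddCommGroup Q] [Module ℝ Q]

/-- A linear endomorphism of a nonzero finite-dimensional real space has a nonzero complex-valued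
eigenfunctional. -/
theorem exists_complex_eigenfunctional [FiniteDimensional ℝ Q] [Nontrivial Q] (S : Q →ₗ[ℝ] Q) :
    ∃ (μ : ℂ) (φ : Q →ₗ[ℝ] ℂ), φ ≠ 0 ∧ ∀ v, φ (S v) = μ * φ v := by
  let A : Module.End ℂ (Q →ₗ[ℝ] ℂ) :=
    { toFun := fun φ => φ ∘ₗ S
      map_add' := fun _ _ => rfl
      map_smul' := fun _ _ => rfl }
  have : Module.Finite ℂ (Q →ₗ[ℝ] ℂ) := Module.Finite.of_restrictScalars_finite ℝ ℂ _
  have : Nontrivial (Q →ₗ[ℝ] ℂ) := by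
    obtain ⟨v, hv⟩ := exists_ne (0 : Q)
    obtain ⟨f, hf⟩ := Module.Projective.exists_dual_ne_zero ℝ hv
    refine ⟨Complex.ofRealCLM.toLinearMap ∘ₗ f, 0, fun h => hf ?_⟩
    simpa using LinearMap.congr_fun h v
  obtain ⟨μ, hμ⟩ := Module.End.exists_eigenvalue A
  obtain ⟨φ, hφ⟩ := hμ.exists_hasEigenvector
  exact ⟨μ, φ, hφ.2, fun v => LinearMap.congr_fun hφ.apply_eq_smul v⟩

/-- Powers of a complex number times a constant never have moduli dense in `[0, ∞)`. -/
theorem exists_interval_avoiding_pow_mul (r s : ℝ) (hr : 0 ≤ r) (hs : 0 ≤ s) :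
    ∃ a b : ℝ, 0 < a ∧ a < b ∧ ∀ n : ℕ, r ^ n * s ∉ Set.Ioo a b := by
  rcases le_total r 1 with h | h
  · refine ⟨s + 1, s + 2, by linarith, by linarith, fun n hn => ?_⟩
    have := mul_le_of_le_one_left hs (pow_le_one₀ hr h (n := n))
    linarith [hn.1]
  · rcases hs.eq_or_lt with rfl | hs
    · exact ⟨1, 2, one_pos, one_lt_two, fun n hn => by simp at hn; linarith⟩
    · refine ⟨s / 2, s, by linarith, by linarith, fun n hn => ?_⟩
      have := le_mul_of_one_le_left hs.le (one_le_pow₀ h (n := n))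
      linarith [hn.2]

/-- There are no dense orbits of linear maps on nonzero finite-dimensional real spaces. -/
theorem not_denseRange_pow_of_finiteDimensional [TopologicalSpace Q] [IsTopologicalAddGroup Q]
    [ContinuousSMul ℝ Q] [T2Space Q] [FiniteDimensional ℝ Q] [Nontrivial Q]
    (S : Q →L[ℝ] Q) (x : Q) : ¬ DenseRange fun n : ℕ => (S ^ n) x := by
  intro hd
  obtain ⟨μ, φ, hφ, hS⟩ := exists_complex_eigenfunctional S.toLinearMap
  have hpow : ∀ n : ℕ, φ ((S ^ n) x) = μ ^ n * φ x := by
    intro n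
    induction n with
    | zero => simp
    | succ n ih =>
      rw [pow_succ', mul_apply_eq_comp, pow_succ', mul_assoc, ← ih]
      exact hS _
  obtain ⟨a, b, ha, hab, hno⟩ :=
    exists_interval_avoiding_pow_mul ‖μ‖ ‖φ x‖ (norm_nonneg _) (norm_nonneg _)
  have hc : Continuous fun v => ‖φ v‖ := (LinearMap.continuous_of_finiteDimensional φ).norm
  obtain ⟨v, hv⟩ : ∃ v, φ v ≠ 0 := by
    by_contra! h
    exact hφ (LinearMap.ext h)
  have hv' : 0 < ‖φ v‖ := norm_pos_iff.2 hv
  have hb := ha.trans hab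
  -- The witness is `v` rescaled so that `‖φ ·‖` takes the midpoint value of the avoided interval.
  obtain ⟨n, hn⟩ := hd.exists_mem_open ((isOpen_Ioo (a := a) (b := b)).preimage hc)
    ⟨((a + b) / 2 / ‖φ v‖) • v, by
      have : ‖φ (((a + b) / 2 / ‖φ v‖) • v)‖ = (a + b) / 2 := by
        rw [map_smul, norm_smul, Real.norm_of_nonneg (by positivity)]
        field_simp
      simp only [Set.mem_preimage, this]
      constructor <;> linarith⟩
  apply hno n
  simpa only [Set.mem_preimage, hpow, norm_mul, norm_pow] using hn

end DenseRange

/-! ### Polynomials in an operator with a dense orbit -/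

section Orbit

variable {X : Type*} [AddCommGroup X] [Module ℝ X] [TopologicalSpace X]
  [IsTopologicalAddGroup X] [ContinuousSMul ℝ X]

/-- If `T` has a dense orbit then `p(T)` has dense range for every nonzero polynomial `p`. -/
theorem denseRange_aeval {T : X →L[ℝ] X} {x : X} (hx : DenseRange fun n : ℕ => (T ^ n) x)
    {p : ℝ[X]} (hp : p ≠ 0) : DenseRange (aeval T p) := by
  set R : X →L[ℝ] X := aeval T p with hR
  set Y : Submodule ℝ X := R.toLinearMap.range.topologicalClosure with hY
  have hYc : IsClosed (Y : Set X) := Submodule.isClosed_topologicalClosure _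
  have hTR : ∀ v, T (R v) = R (T v) := fun v => by
    have : Commute T R := by
      have := (Polynomial.aeval_X (R := ℝ) T)
      conv_lhs => rw [← this]
      exact (Commute.all (Polynomial.X : ℝ[X]) p).map (aeval T)
    exact DFunLike.congr_fun this v
  have hTY : Y ≤ Y.comap T.toLinearMap := by
    refine Submodule.topologicalClosure_minimal _ ?_ (hYc.preimage T.continuous)
    rintro _ ⟨v, rfl⟩
    exact Submodule.le_topologicalClosure _ ⟨T v, (hTR v).symm⟩
  -- The quotient by the closed range of `p(T)` inherits a dense orbit, but `p` annihilates the
  -- induced operator.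
  let S : (X ⧸ Y) →L[ℝ] (X ⧸ Y) :=
    ⟨Y.mapQ Y T.toLinearMap hTY, by
      refine continuous_quot_lift _ ?_
      exact continuous_quot_mk.comp T.continuous⟩
  have hS : ∀ v, S (Y.mkQ v) = Y.mkQ (T v) := fun v => rfl
  have hSpow : ∀ (n : ℕ) v, (S ^ n) (Y.mkQ v) = Y.mkQ ((T ^ n) v) := by
    intro n
    induction n with
    | zero => intro v; rfl
    | succ n ih =>
      intro v
      rw [pow_succ, pow_succ, mul_apply_eq_comp, hS, ih]; rfl
  have hSp : ∀ (q : ℝ[X]) v, (aeval S q) (Y.mkQ v) = Y.mkQ ((aeval T q) v) := by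
    intro q v
    induction q using Polynomial.induction_on' with
    | add q r hq hr => rw [map_add, map_add, _root_.add_apply, hq, hr, ← map_add]; rfl
    | monomial n a =>
      simp only [aeval_monomial, mul_apply_eq_comp, hSpow]
      simp [Algebra.algebraMap_eq_smul_one]
  have hdense : DenseRange fun n : ℕ => (S ^ n) (Y.mkQ x) := by
    simp only [hSpow]
    exact (Y.mkQ_surjective.denseRange).comp hx continuous_quot_mk
  -- Closedness of `Y` makes the quotient Hausdorff, although `X` itself need not be.
  have : IsClosed (Y.toAddSubgroup : Set X) := hYc
  have : T3Space (X ⧸ Y) := inferInstanceAs (T3Space (X ⧸ Y.toAddSubgroup))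
  have hann : aeval S p = 0 := by
    ext w
    obtain ⟨v, rfl⟩ := Y.mkQ_surjective w
    rw [hSp]
    simpa using Submodule.le_topologicalClosure R.toLinearMap.range ⟨v, rfl⟩
  let ev : ((X ⧸ Y) →L[ℝ] (X ⧸ Y)) →ₗ[ℝ] (X ⧸ Y) :=
    { toFun := fun A => A (Y.mkQ x)
      map_add' := fun _ _ => rfl
      map_smul' := fun _ _ => rfl }
  have hint : IsIntegral ℝ S := (show IsAlgebraic ℝ S from ⟨p, hp, hann⟩).isIntegral
  have hfin : Module.Finite ℝ ((Algebra.adjoin ℝ {S}).toSubmodule.map ev) :=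
    Module.Finite.iff_fg.2 (hint.fg_adjoin_singleton.map ev)
  -- This subspace is finite-dimensional, hence closed, and it contains a dense orbit.
  have htop : (Algebra.adjoin ℝ {S}).toSubmodule.map ev = ⊤ := by
    refine SetLike.coe_injective ?_
    rw [← (Submodule.closed_of_finiteDimensional _).closure_eq]
    refine (hdense.mono ?_).closure_eq
    rintro _ ⟨n, rfl⟩
    exact ⟨S ^ n, pow_mem (Algebra.self_mem_adjoin_singleton ℝ S) n, rfl⟩
  have hfin' : FiniteDimensional ℝ (X ⧸ Y) := by
    rw [htop] at hfin
    exact Module.finite_def.2 (Module.Finite.iff_fg.1 hfin)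
  rcases subsingleton_or_nontrivial (X ⧸ Y) with hsub | hnon
  · have hYtop := Submodule.Quotient.subsingleton_iff.1 hsub
    have := congrArg (fun Z : Submodule ℝ X => (Z : Set X)) hYtop
    exact dense_iff_closure_eq.2 this
  · exact absurd hdense (not_denseRange_pow_of_finiteDimensional S _)

/-- If `x` has a dense orbit under `T`, then so does `p(T) x` for every nonzero polynomial `p`. -/
theorem denseRange_pow_aeval {T : X →L[ℝ] X} {x : X} (hx : DenseRange fun n : ℕ => (T ^ n) x)
    {p : ℝ[X]} (hp : p ≠ 0) : DenseRange fun n : ℕ => (T ^ n) (aeval T p x) := by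
  have := (denseRange_aeval hx hp).comp hx (aeval T p).continuous
  convert! this using 2 with n
  have h : Commute (T ^ n) (aeval T p) := by
    have h := (Commute.all ((Polynomial.X : ℝ[X]) ^ n) p).map (aeval T)
    simpa using h
  exact DFunLike.congr_fun h x

end Orbit

/-! ### Closed subgroups of the circle -/

/-- A proper closed subgroup of the circle is the group of `m`-th roots of unity for some `m`. -/
theorem exists_mem_iff_pow_eq_one_of_isClosed (H : Subgroup Circle) (hH : IsClosed (H : Set Circle))
    (hne : H ≠ ⊤) : ∃ m : ℕ, ∀ h, h ∈ H ↔ h ^ m = 1 := by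
  let S : AddSubgroup ℝ :=
    { carrier := {t | Circle.exp t ∈ H}
      zero_mem' := by simp [H.one_mem]
      add_mem' := fun {a b} ha hb => by
        simpa only [Set.mem_ofPred_eq, Circle.exp_add] using H.mul_mem ha hb
      neg_mem' := fun {a} ha => by
        simpa only [Set.mem_ofPred_eq, Circle.exp_neg] using H.inv_mem ha }
  have hmem : ∀ t, t ∈ S ↔ Circle.exp t ∈ H := fun t => Iff.rfl
  have hSc : IsClosed (S : Set ℝ) := hH.preimage Circle.exp.continuous
  rcases S.dense_or_cyclic with hd | ⟨a, ha⟩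
  · refine absurd (eq_top_iff.2 fun h _ => ?_) hne
    obtain ⟨t, rfl⟩ := Circle.exp_surjective h
    have : t ∈ (S : Set ℝ) := by
      rw [← hSc.closure_eq]
      exact hd t
    exact this
  · have hpi : 2 * Real.pi ∈ S := by simp [hmem, H.one_mem]
    have ha' : ∀ t, t ∈ S ↔ ∃ k : ℤ, k • a = t := fun t => by
      rw [ha, AddSubgroup.mem_closure_singleton]
    obtain ⟨k, hk⟩ := (ha' _).1 hpi
    have hpos := Real.two_pi_pos
    have hk0 : (k : ℝ) ≠ 0 := by
      rintro h0
      simp [h0] at hk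
    have hka : (k : ℝ) * a = 2 * Real.pi := by simpa using hk
    have key : ∀ h : Circle, h ∈ H ↔ h ^ k = 1 := by
      intro h
      obtain ⟨t, rfl⟩ := Circle.exp_surjective h
      rw [← hmem, ha', ← Circle.exp_zsmul, Circle.exp_eq_one]
      refine exists_congr fun j => ?_
      simp only [zsmul_eq_mul, ← hka]
      constructor
      · rintro rfl; ring
      · intro h
        apply mul_left_cancel₀ hk0
        linarith
    refine ⟨k.natAbs, fun h => (key h).trans ?_⟩
    rcases Int.natAbs_eq k with h' | h' <;> rw [h'] <;> simp

/-! ### Joint orbits in `X × Circle` -/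

section Joint

variable {X : Type*} [AddCommGroup X] [Module ℝ X] [TopologicalSpace X]

/-- The closure of the joint orbit of `(y, 1)` under `T` and multiplication by `g`. -/
def jointOrbitClosure (T : X →L[ℝ] X) (g : Circle) (y : X) : Set (X × Circle) :=
  closure (Set.range fun n : ℕ => ((T ^ n) y, g ^ n))

variable {T : X →L[ℝ] X} {g : Circle}

theorem isClosed_jointOrbitClosure (y : X) : IsClosed (jointOrbitClosure T g y) := isClosed_closure

theorem pow_mem_jointOrbitClosure (y : X) (n : ℕ) :
    ((T ^ n) y, g ^ n) ∈ jointOrbitClosure T g y :=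
  subset_closure ⟨n, rfl⟩

/-- Projecting along the compact circle is a closed map, so the image of the closure is closed as
well as dense. -/
theorem exists_mem_jointOrbitClosure {y : X} (hy : DenseRange fun n : ℕ => (T ^ n) y) (z : X) :
    ∃ h, (z, h) ∈ jointOrbitClosure T g y := by
  have hc : IsClosed (Prod.fst '' jointOrbitClosure T g y) :=
    isClosedMap_fst_of_compactSpace _ (isClosed_jointOrbitClosure y)
  have hd : Dense (Prod.fst '' jointOrbitClosure T g y) := by
    refine hy.mono ?_
    rintro _ ⟨n, rfl⟩
    exact ⟨_, pow_mem_jointOrbitClosure y n, rfl⟩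
  obtain ⟨⟨_, h⟩, hh, rfl⟩ := (hc.closure_eq ▸ hd z : z ∈ Prod.fst '' jointOrbitClosure T g y)
  exact ⟨h, hh⟩

theorem mul_mem_jointOrbitClosure {y z w : X} {h k : Circle}
    (hh : (z, h) ∈ jointOrbitClosure T g y) (hk : (w, k) ∈ jointOrbitClosure T g z) :
    (w, h * k) ∈ jointOrbitClosure T g y := by
  have step : ∀ n : ℕ, ((T ^ n) z, h * g ^ n) ∈ jointOrbitClosure T g y := by
    intro n
    have hc : Continuous fun q : X × Circle => ((T ^ n) q.1, q.2 * g ^ n) := by fun_prop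
    refine map_mem_closure (f := fun q : X × Circle => ((T ^ n) q.1, q.2 * g ^ n)) hc hh ?_
    rintro _ ⟨j, rfl⟩
    exact ⟨n + j, by simp only [pow_add, mul_apply_eq_comp, mul_comm (g ^ n)]⟩
  have hc : Continuous fun q : X × Circle => (q.1, h * q.2) := by fun_prop
  have := map_mem_closure hc hk (t := jointOrbitClosure T g y) (by
    rintro _ ⟨n, rfl⟩
    exact step n)
  rwa [(isClosed_jointOrbitClosure y).closure_eq] at this

/-- The closed subgroup of the circle elements `h` with `(x, h)` in the joint orbit closure
of `x`. -/
def jointStabilizer (T : X →L[ℝ] X) (g : Circle) (x : X) : Subgroup Circle where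
  carrier := {h | (x, h) ∈ jointOrbitClosure T g x}
  one_mem' := by simpa using pow_mem_jointOrbitClosure (T := T) (g := g) x 0
  mul_mem' := mul_mem_jointOrbitClosure
  inv_mem' := fun {h} hh => by
    have hpow : ∀ n : ℕ, (x, h ^ n) ∈ jointOrbitClosure T g x := by
      intro n
      induction n with
      | zero => simpa using pow_mem_jointOrbitClosure (T := T) (g := g) x 0
      | succ n ih => rw [pow_succ]; exact mul_mem_jointOrbitClosure ih hh
    have hc : IsClosed {k : Circle | (x, k) ∈ jointOrbitClosure T g x} :=
      (isClosed_jointOrbitClosure x).preimage (by fun_prop)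
    -- In a compact group the closure of the positive powers already contains the inverse.
    have hcl : h⁻¹ ∈ closure (Set.range fun n : ℕ => h ^ n) := by
      rw [← closure_range_zpow_eq_pow]
      exact subset_closure ⟨-1, by simp⟩
    refine closure_minimal ?_ hc hcl
    rintro _ ⟨n, rfl⟩
    exact hpow n

theorem mem_jointStabilizer {x : X} {h : Circle} :
    h ∈ jointStabilizer T g x ↔ (x, h) ∈ jointOrbitClosure T g x := Iff.rfl

theorem isClosed_jointStabilizer (x : X) : IsClosed (jointStabilizer T g x : Set Circle) :=
  (isClosed_jointOrbitClosure x).preimage (by fun_prop : Continuous fun k : Circle => (x, k))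

/-- If `g` does not stabilize `x`, there is a continuous circle-valued function on the set of
vectors with dense orbit that `T` multiplies by a constant different from `1`. -/
theorem exists_equivariant_map {x : X} (hx : DenseRange fun n : ℕ => (T ^ n) x)
    (hg : g ∉ jointStabilizer T g x) :
    ∃ (χ : Circle) (f : {y : X // DenseRange fun n : ℕ => (T ^ n) y} → Circle),
      χ ≠ 1 ∧ Continuous f ∧ f ⟨x, hx⟩ = 1 ∧
      ∀ y z : {y : X // DenseRange fun n : ℕ => (T ^ n) y}, ∀ k : ℕ, (z : X) = (T ^ k) y →
        f z = χ ^ k * f y := by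
  obtain ⟨m, hm⟩ := exists_mem_iff_pow_eq_one_of_isClosed _ (isClosed_jointStabilizer x)
    (fun h => hg (h ▸ Subgroup.mem_top g))
  choose F hF using fun y : {y : X // DenseRange fun n : ℕ => (T ^ n) y} =>
    exists_mem_jointOrbitClosure (g := g) hx y
  -- Returning from `y` to `x` by a common `k` puts both `h * k` and `F y * k` in the stabilizer, so
  -- the choice of `F y` is immaterial after taking `m`-th powers.
  have huniq : ∀ (y : {y : X // DenseRange fun n : ℕ => (T ^ n) y}) (h : Circle),
      ((y : X), h) ∈ jointOrbitClosure T g x → h ^ m = F y ^ m := by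
    intro y h hh
    obtain ⟨k, hk⟩ := exists_mem_jointOrbitClosure (g := g) y.2 x
    have h1 := (hm _).1 (mem_jointStabilizer.2 (mul_mem_jointOrbitClosure hh hk))
    have h2 := (hm _).1 (mem_jointStabilizer.2 (mul_mem_jointOrbitClosure (hF y) hk))
    rw [mul_pow] at h1 h2
    exact mul_right_cancel (h1.trans h2.symm)
  refine ⟨g ^ m, fun y => F y ^ m, fun h => hg ((hm g).2 h), ?_, ?_, ?_⟩
  · rw [continuous_iff_isClosed]
    intro C hC
    have hcl : IsClosed (Prod.fst '' (jointOrbitClosure T g x ∩ {q | q.2 ^ m ∈ C})) :=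
      isClosedMap_fst_of_compactSpace _
        ((isClosed_jointOrbitClosure x).inter (hC.preimage (by fun_prop)))
    convert hcl.preimage continuous_subtype_val using 1
    ext y
    constructor
    · intro hy
      exact ⟨(y, F y), ⟨hF y, hy⟩, rfl⟩
    · rintro ⟨⟨_, h⟩, ⟨hh, hC'⟩, rfl⟩
      have hC'' : h ^ m ∈ C := hC'
      rwa [huniq y h hh] at hC''
  · have := huniq ⟨x, hx⟩ 1 (jointStabilizer T g x).one_mem
    simpa using this.symm
  · rintro y z k hz
    have h1 := mul_mem_jointOrbitClosure (hF y) (pow_mem_jointOrbitClosure (y : X) k)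
    rw [← hz] at h1
    have := huniq z _ h1
    change F z ^ m = (g ^ m) ^ k * F y ^ m
    rw [← this, mul_pow, mul_comm, ← pow_mul, ← pow_mul, mul_comm k]

end Joint

/-! ### Winding along combinations of orbit points -/

/-- A continuous angle that starts at `0` and keeps a positive cosine stays below `π / 2`. -/
theorem abs_lt_pi_div_two_of_cos_pos {δ : ℝ → ℝ} (hδ : Continuous δ) (h0 : δ 0 = 0)
    (hcos : ∀ t ∈ Set.Icc (0 : ℝ) 1, 0 < Real.cos (δ t)) : |δ 1| < Real.pi / 2 := by
  by_contra! h
  obtain ⟨t, ht, htδ⟩ := intermediate_value_Icc zero_le_one (f := fun t => |δ t|)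
    hδ.abs.continuousOn ⟨by simpa [h0] using Real.pi_div_two_pos.le, h⟩
  have := hcos t ht
  rw [← Real.cos_abs, show |δ t| = Real.pi / 2 from htδ, Real.cos_pi_div_two] at this
  exact lt_irrefl _ this

/-- Two continuous lifts of circle-valued functions that differ by a constant factor differ by a
constant. -/
theorem sub_eq_sub_of_exp_eq_mul {θ η : ℝ → ℝ} (hθ : Continuous θ) (hη : Continuous η)
    (c : Circle) (h : ∀ t, Circle.exp (θ t) = c * Circle.exp (η t)) (s t : ℝ) :
    θ s - θ t = η s - η t := by
  have hc : Circle.exp (θ t - η t) = c := by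
    rw [Circle.exp_sub, h t, mul_div_cancel_right]
  have := Circle.isCoveringMap_exp.eq_of_comp_eq hθ
    (show Continuous fun s => θ t - η t + η s by fun_prop)
    (funext fun s => by simp only [Function.comp, h s, Circle.exp_add, hc]) t (by ring)
  have := congrFun this s
  linarith

section

variable {X : Type*} [AddCommGroup X] [Module ℝ X]

/-- The combination of `x, T x, …, Tⁿ x` with coefficients `|a k|`, corrected by a multiple of `x`
so that the coefficients never sum to less than `1`. -/
noncomputable def orbitCombination [TopologicalSpace X] (T : X →L[ℝ] X) (x : X) (n : ℕ)
    (a : ℕ → ℝ) : X :=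
  ∑ k ∈ Finset.range (n + 1), |a k| • (T ^ k) x +
    max 0 (1 - ∑ k ∈ Finset.range (n + 1), |a k|) • x

theorem sum_range_edge {M : Type*} [AddCommMonoid M] [Module ℝ M] (w : ℕ → M) {n i j : ℕ}
    (hi : i ≤ n) (hj : j ≤ n) (hij : i ≠ j) (t : ℝ) :
    ∑ k ∈ Finset.range (n + 1),
      |((1 - t) • Pi.single i (1 : ℝ) + t • Pi.single j (1 : ℝ) : ℕ → ℝ) k| • w k =
      |1 - t| • w i + |t| • w j := by
  rw [Finset.sum_eq_add_of_mem i j (by simp; omega) (by simp; omega) hij]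
  · simp [hij, hij.symm]
  · rintro k - ⟨hki, hkj⟩
    simp [hki, hkj]

variable [TopologicalSpace X]

theorem orbitCombination_edge (T : X →L[ℝ] X) (x : X) {n i j : ℕ}
    (hi : i ≤ n) (hj : j ≤ n) (hij : i ≠ j) (t : ℝ) :
    orbitCombination T x n ((1 - t) • Pi.single i (1 : ℝ) + t • Pi.single j (1 : ℝ)) =
      |1 - t| • (T ^ i) x + |t| • (T ^ j) x := by
  have h1 := sum_range_edge (fun k => (T ^ k) x) hi hj hij t
  have h2 := sum_range_edge (fun _ => (1 : ℝ)) hi hj hij t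
  simp only [smul_eq_mul, mul_one] at h2
  rw [orbitCombination, h1, h2, max_eq_left, zero_smul, add_zero]
  have := abs_add_le (1 - t) t
  rw [sub_add_cancel, abs_one] at this
  linarith

variable [IsTopologicalAddGroup X] [ContinuousSMul ℝ X]

theorem continuous_orbitCombination (T : X →L[ℝ] X) (x : X) (n : ℕ) :
    Continuous (orbitCombination T x n) := by
  unfold orbitCombination
  fun_prop

/-- The combination is `p(T) x` with `p` of value at least `1` at `1`, so `p ≠ 0` for every `a`.
This allows all of `ℕ → ℝ`, where lifts to the line exist, as parameter space. -/
theorem denseRange_orbitCombination {T : X →L[ℝ] X} {x : X}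
    (hx : DenseRange fun n : ℕ => (T ^ n) x) (n : ℕ) (a : ℕ → ℝ) :
    DenseRange fun k : ℕ => (T ^ k) (orbitCombination T x n a) := by
  let p : ℝ[X] := ∑ k ∈ Finset.range (n + 1), C |a k| * Polynomial.X ^ k +
    C (max 0 (1 - ∑ k ∈ Finset.range (n + 1), |a k|))
  have hp : p ≠ 0 := by
    intro h
    have h1 : p.eval 1 = 0 := by rw [h, eval_zero]
    simp only [p, eval_add, eval_finsetSum, eval_mul, eval_C, eval_pow, eval_X, one_pow,
      mul_one] at h1
    linarith [le_max_right 0 (1 - ∑ k ∈ Finset.range (n + 1), |a k|)]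
  have hpx : aeval T p x = orbitCombination T x n a := by
    simp only [p, orbitCombination, map_add, map_sum, map_mul, map_pow, aeval_C, aeval_X,
      Algebra.algebraMap_eq_smul_one, smul_mul_assoc, one_mul, _root_.add_apply,
      _root_.sum_apply]
    rfl
  rw [← hpx]
  exact denseRange_pow_aeval hx hp

/-- The joint orbit closure of a vector with dense orbit contains `(x, g)`. -/
theorem mem_jointStabilizer_of_denseRange {T : X →L[ℝ] X} {x : X}
    (hx : DenseRange fun n : ℕ => (T ^ n) x) (g : Circle) : g ∈ jointStabilizer T g x := by
  by_contra hg
  obtain ⟨χ, f, hχ, hf, hfx, hfT⟩ := exists_equivariant_map hx hg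
  have hopen : IsOpen {y | 0 < ((f y : Circle) : ℂ).re} :=
    isOpen_lt continuous_const (by fun_prop)
  obtain ⟨U, hU, hUf⟩ := isOpen_induced_iff.1 hopen
  have hxU : x ∈ U := by
    have : (⟨x, hx⟩ : {y : X // DenseRange fun n : ℕ => (T ^ n) y}) ∈ Subtype.val ⁻¹' U := by
      rw [hUf]
      simp [hfx]
    exact this
  have hU0 : (fun v => x + v) ⁻¹' U ∈ 𝓝 (0 : X) :=
    (hU.preimage (by fun_prop)).mem_nhds (by simpa using hxU)
  obtain ⟨V, ⟨hV, hVb⟩, hVU⟩ := (nhds_basis_balanced ℝ X).mem_iff.1 hU0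
  have hpos : 0 < ‖(χ : ℂ) - 1‖ := norm_pos_iff.2 (sub_ne_zero.2 fun h => hχ (Circle.ext h))
  -- With this `N`, at least `N` steps of angle at least `‖χ - 1‖` make up `π / 2`.
  obtain ⟨N, hN⟩ := exists_nat_ge (Real.pi / 2 / ‖(χ : ℂ) - 1‖)
  rw [div_le_iff₀ hpos] at hN
  obtain ⟨n, hn0, hnN, hnV⟩ : ∃ n, n ≠ 0 ∧ N ≤ n ∧ (T ^ n) x - x ∈ V := by
    have hd : DenseRange fun k : ℕ => (T ^ k) ((T ^ (N + 1)) x) := by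
      simpa using denseRange_pow_aeval hx (p := Polynomial.X ^ (N + 1)) (by simp)
    have hnear : {z | z - x ∈ V} ∈ 𝓝 x := by
      refine (show Continuous fun z => z - x by fun_prop).continuousAt.preimage_mem_nhds ?_
      simpa using hV
    obtain ⟨W, hWV, hW, hxW⟩ := mem_nhds_iff.1 hnear
    obtain ⟨k, hk⟩ := hd.exists_mem_open hW ⟨x, hxW⟩
    refine ⟨k + (N + 1), by omega, by omega, hWV ?_⟩
    rwa [pow_add, mul_apply_eq_comp]
  let Φ : C(ℕ → ℝ, Circle) :=
    ⟨fun a => f ⟨orbitCombination T x n a, denseRange_orbitCombination hx n a⟩,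
      hf.comp ((continuous_orbitCombination T x n).subtype_mk _)⟩
  obtain ⟨e₀, he₀⟩ := Circle.exp_surjective (Φ 0)
  obtain ⟨θ, ⟨-, hθ⟩, -⟩ :=
    Circle.isCoveringMap_exp.existsUnique_continuousMap_lifts Φ 0 e₀ he₀
  have hθ' : ∀ a, Circle.exp (θ a) = Φ a := fun a => congrFun hθ a
  let edge (i j : ℕ) (t : ℝ) : ℕ → ℝ := (1 - t) • Pi.single i (1 : ℝ) + t • Pi.single j (1 : ℝ)
  have hedge : ∀ i j, Continuous fun t => θ (edge i j t) := fun i j =>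
    θ.continuous.comp (by unfold edge; fun_prop)
  let e (i : ℕ) : ℕ → ℝ := Pi.single i 1
  have hedge0 : ∀ i j, edge i j 0 = e i := fun i j => by simp [edge, e]
  have hedge1 : ∀ i j, edge i j 1 = e j := fun i j => by simp [edge, e]
  -- `T ^ k` carries the edge from `0` to `1` onto the edge from `k` to `k + 1`, so `f` changes by
  -- the constant factor `χ ^ k` and the angle increments agree.
  have hstep : ∀ k, k + 1 ≤ n → θ (e (k + 1)) - θ (e k) = θ (e 1) - θ (e 0) := by
    intro k hk
    have := sub_eq_sub_of_exp_eq_mul (hedge k (k + 1)) (hedge 0 1) (χ ^ k) (fun t => by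
      rw [hθ', hθ']
      refine hfT _ _ k ?_
      change orbitCombination T x n (edge k (k + 1) t) =
        (T ^ k) (orbitCombination T x n (edge 0 1 t))
      rw [orbitCombination_edge T x (by omega) hk (by omega),
        orbitCombination_edge T x (by omega) (by omega) (by omega), map_add, map_smul, map_smul,
        pow_succ, mul_apply_eq_comp, pow_zero, pow_one, one_apply_eq_self]) 1 0
    simpa only [hedge0, hedge1] using this
  have htotal : ∀ k, k ≤ n → θ (e k) - θ (e 0) = k * (θ (e 1) - θ (e 0)) := by
    intro k
    induction k with
    | zero => intro _; simp
    | succ k ih =>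
      intro hk
      have h1 := ih (by omega)
      have h2 := hstep k hk
      push_cast
      linarith
  have hvert : ∀ k, k ≤ n → Circle.exp (θ (e k)) = χ ^ k := by
    intro k hk
    rw [hθ', ← mul_one (χ ^ k), ← hfx]
    refine hfT _ _ k ?_
    change orbitCombination T x n (e k) = (T ^ k) x
    -- A vertex is the start of an edge to any other vertex; the case split only ensures distinct
    -- endpoints.
    rw [← hedge0 k (if k = 0 then n else 0), orbitCombination_edge T x hk]
    · simp
    · split_ifs <;> omega
    · split_ifs <;> omega
  have hα : ‖(χ : ℂ) - 1‖ ≤ |θ (e 1) - θ (e 0)| := by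
    have h : Circle.exp (θ (e 1) - θ (e 0)) = χ := by
      rw [Circle.exp_sub, hvert 1 (by omega), hvert 0 (by omega)]; simp
    rw [← h, Circle.coe_exp, mul_comm]
    exact Real.norm_exp_I_mul_ofReal_sub_one_le
  -- The direct edge is `x + t • (T ^ n x - x)`; since `V` is balanced it stays in `U`, where `f`
  -- has positive real part.
  have hclose : |θ (e n) - θ (e 0)| < Real.pi / 2 := by
    have h := abs_lt_pi_div_two_of_cos_pos (δ := fun t => θ (edge 0 n t) - θ (e 0))
      ((hedge 0 n).sub continuous_const) (by simp [hedge0]) (fun t ht => by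
        have h1 : Circle.exp (θ (edge 0 n t) - θ (e 0)) = Φ (edge 0 n t) := by
          rw [Circle.exp_sub, hvert 0 (by omega), hθ']; simp
        have h2 : Real.cos (θ (edge 0 n t) - θ (e 0)) = ((Φ (edge 0 n t) : Circle) : ℂ).re := by
          rw [← h1, Circle.coe_exp, Complex.exp_ofReal_mul_I_re]
        rw [h2]
        have h3 : orbitCombination T x n (edge 0 n t) ∈ U := by
          rw [orbitCombination_edge T x (by omega) le_rfl hn0.symm, abs_of_nonneg ht.1,
            abs_of_nonneg (sub_nonneg.2 ht.2)]
          have : x + t • ((T ^ n) x - x) ∈ U := hVU (hVb.smul_mem (a := t) (by rw [Real.norm_of_nonneg ht.1]; exact ht.2) hnV)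
          convert this using 1
          rw [pow_zero, one_apply_eq_self]
          module
        have h4 : (⟨_, denseRange_orbitCombination hx n (edge 0 n t)⟩ :
          {y : X // DenseRange fun n : ℕ => (T ^ n) y}) ∈ Subtype.val ⁻¹' U := h3
        rw [hUf] at h4
        exact h4)
    simpa only [hedge1] using h
  rw [htotal n le_rfl, abs_mul, Nat.abs_cast] at hclose
  have : (N : ℝ) ≤ n := by exact_mod_cast hnN
  nlinarith [mul_le_mul this hα hpos.le (Nat.cast_nonneg n)]

/-- For a vector `x` with dense orbit, `Tⁿ x` comes close to any given vector along times `n` for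
which `gⁿ` is close to a given power of `g`. -/
theorem exists_pow_mem_and_pow_mem {T : X →L[ℝ] X} {x : X}
    (hx : DenseRange fun n : ℕ => (T ^ n) x) (g : Circle) (i : ℤ) {U : Set X} (hU : IsOpen U)
    (hne : U.Nonempty) {W : Set Circle} (hW : W ∈ 𝓝 (g ^ i)) :
    ∃ n : ℕ, (T ^ n) x ∈ U ∧ g ^ n ∈ W := by
  obtain ⟨m, hm⟩ := hx.exists_mem_open hU hne
  have hg := mem_jointStabilizer_of_denseRange hx g
  -- The stabilizer is a group, so `g ^ (i - m)` belongs to it even for a negative exponent; moving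
  -- on by `m` steps gives `g ^ i`.
  have h1 : ((T ^ m) x, g ^ i) ∈ jointOrbitClosure T g x := by
    have := mul_mem_jointOrbitClosure
      (mem_jointStabilizer.1 (zpow_mem hg (i - m))) (pow_mem_jointOrbitClosure (g := g) x m)
    rwa [← zpow_natCast, ← zpow_add, sub_add_cancel] at this
  obtain ⟨_, ⟨hnU, hnW⟩, n, rfl⟩ :=
    mem_closure_iff_nhds.1 h1 (U ×ˢ W) (prod_mem_nhds (hU.mem_nhds hm) hW)
  exact ⟨n, hnU, hnW⟩

end

theorem HasCuSP.iUnion_mem {F : Set (Set ℕ)} (hF : HasCuSP F) {ι : Type*} [Fintype ι] [Nonempty ι]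
    (I : ι → Set ℕ) (n : ι → ℕ) (hI : (⋃ j, I j) = Set.univ) {A : Set ℕ} (hA : A ∈ F) :
    (⋃ j, (fun k => n j + k) '' (A ∩ I j)) ∈ F := by
  let e := (Fintype.equivFin ι).symm
  have := hF (Fintype.card ι) Fintype.card_pos (I ∘ e) (n ∘ e)
    (by rw [← hI]; exact e.surjective.iUnion_comp I) A hA
  rwa [show (⋃ j, (fun k => (n ∘ e) j + k) '' (A ∩ (I ∘ e) j)) =
    ⋃ j, (fun k => n j + k) '' (A ∩ I j) from
      e.surjective.iUnion_comp fun j => (fun k => n j + k) '' (A ∩ I j)] at this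

/-! ### Roots of unity and unimodular scalars -/

section Circle

theorem exists_circle_pow_eq_one_iff {p : ℕ} (hp : 1 ≤ p) :
    ∃ g : Circle, ∀ n : ℕ, g ^ n = 1 ↔ p ∣ n := by
  have hp0 : (p : ℝ) ≠ 0 := by positivity
  refine ⟨Circle.exp (2 * Real.pi / p), fun n => ?_⟩
  rw [← Circle.exp_nsmul, Circle.exp_eq_one, ← Int.natCast_dvd_natCast]
  refine exists_congr fun k => ?_
  have hpi := Real.two_pi_pos.ne'
  rw [nsmul_eq_mul]
  constructor
  · intro h
    field_simp at h
    have : (n : ℝ) = p * k := by linarith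
    exact_mod_cast this
  · intro h
    have : (n : ℝ) = p * k := by exact_mod_cast h
    rw [this]
    field_simp

/-- A unimodular scalar is the image of an element of the circle, compatibly with powers. -/
theorem exists_circle_map_pow_eq {𝕜 : Type*} [RCLike 𝕜] {c : 𝕜} (hc : ‖c‖ = 1) :
    ∃ g : Circle, ∀ n : ℕ, RCLike.map ℂ 𝕜 ((g ^ n : Circle) : ℂ) = c ^ n := by
  have hpow : ∀ n : ℕ, (RCLike.map 𝕜 ℂ c) ^ n = RCLike.map 𝕜 ℂ (c ^ n) := by
    intro n
    induction n with
    | zero => simp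
    | succ n ih =>
      rw [pow_succ, ih, pow_succ]
      apply Complex.ext <;> simp
  have hnorm : ‖RCLike.map 𝕜 ℂ c‖ = 1 := by
    rw [← hc, ← sq_eq_sq₀ (norm_nonneg _) (norm_nonneg _), ← RCLike.normSq_eq_def',
      ← RCLike.normSq_eq_def', RCLike.normSq_apply, RCLike.normSq_apply]
    simp
  obtain ⟨g, hg⟩ : ∃ g : Circle, (g : ℂ) = RCLike.map 𝕜 ℂ c :=
    ⟨⟨_, mem_sphere_zero_iff_norm.2 hnorm⟩, rfl⟩
  refine ⟨g, fun n => ?_⟩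
  rw [Circle.coe_pow, hg, hpow]
  simp

end Circle

/-! ### Transfer to `F`-hypercyclic vectors -/

section Hypercyclic

variable {𝕜 X : Type*} [RCLike 𝕜] [AddCommGroup X] [Module 𝕜 X] [TopologicalSpace X]

theorem IsFHypercyclicVector.denseRange {F : Set (Set ℕ)} (hF : IsFurstenbergFamily F)
    {T : X →L[𝕜] X} {x : X} (hx : IsFHypercyclicVector F T x) :
    DenseRange fun n : ℕ => (T ^ n) x := by
  refine dense_iff_inter_open.2 fun V hV hne => ?_
  obtain ⟨n, hn⟩ : (returnSet T x V).Nonempty := by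
    rw [Set.nonempty_iff_ne_empty]
    intro h
    exact hF.empty_notMem (h ▸ hx V hV hne)
  exact ⟨_, hn, n, rfl⟩

theorem IsFHypercyclicVector.of_pow {F : Set (Set ℕ)} (hF : IsFurstenbergFamily F) {p : ℕ}
    (hpF : ∀ A : Set ℕ, A ∈ F ↔ (fun n => p * n) '' A ∈ F) {T : X →L[𝕜] X} {x : X}
    (hx : IsFHypercyclicVector F (T ^ p) x) : IsFHypercyclicVector F T x := by
  intro U hU hne
  refine hF.mono _ ((hpF _).1 (hx U hU hne)) _ ?_
  rintro _ ⟨n, hn, rfl⟩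
  change (T ^ (p * n)) x ∈ U
  rw [pow_mul]
  exact hn

variable [IsTopologicalAddGroup X] [ContinuousSMul 𝕜 X]

theorem exists_pow_mem_and_circle_pow_mem {T : X →L[𝕜] X} {x : X}
    (hx : DenseRange fun n : ℕ => (T ^ n) x) (g : Circle) (i : ℤ) {U : Set X} (hU : IsOpen U)
    (hne : U.Nonempty) {W : Set Circle} (hW : W ∈ 𝓝 (g ^ i)) :
    ∃ n : ℕ, (T ^ n) x ∈ U ∧ g ^ n ∈ W := by
  let _ : Module ℝ X := Module.compHom X (algebraMap ℝ 𝕜)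
  have : IsScalarTower ℝ 𝕜 X := ⟨fun r a v => by
    rw [Algebra.smul_def, mul_smul]; rfl⟩
  have : ContinuousSMul ℝ X := ⟨by
    have : Continuous fun q : ℝ × X => (algebraMap ℝ 𝕜 q.1) • q.2 :=
      (RCLike.continuous_ofReal.comp continuous_fst).smul continuous_snd
    exact this⟩
  have hpow : ∀ n : ℕ, ((T.restrictScalars ℝ) ^ n) x = (T ^ n) x := by
    intro n
    induction n with
    | zero => rfl
    | succ n ih => rw [pow_succ', pow_succ', mul_apply_eq_comp, mul_apply_eq_comp, ih]; rfl
  have := exists_pow_mem_and_pow_mem (T := T.restrictScalars ℝ) (x := x)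
    (by simpa only [hpow] using hx) g i hU hne hW
  simpa only [hpow] using this

/-- Visits of a dense orbit to an open set in a prescribed residue class of times. -/
theorem exists_pow_mem_and_dvd_add {T : X →L[𝕜] X} {x : X}
    (hx : DenseRange fun n : ℕ => (T ^ n) x) {p : ℕ} (hp : 1 ≤ p) (j : ℕ) {U : Set X}
    (hU : IsOpen U) (hne : U.Nonempty) : ∃ n : ℕ, (T ^ n) x ∈ U ∧ p ∣ n + j := by
  obtain ⟨g, hg⟩ := exists_circle_pow_eq_one_iff hp
  have hgp : g ^ p = 1 := (hg p).2 dvd_rfl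
  -- Removing the finitely many other powers of `g` leaves a neighbourhood that forces `g ^ n = g ^
  -- (-j)` exactly.
  have hfin : (Set.range (fun k : Fin p => g ^ (k : ℕ)) \ {g ^ (-(j : ℤ))}).Finite :=
    (Set.finite_range _).sdiff
  obtain ⟨n, hnU, hn⟩ := exists_pow_mem_and_circle_pow_mem hx g (-j) hU hne
    (hfin.isClosed.isOpen_compl.mem_nhds (by simp))
  refine ⟨n, hnU, (hg _).1 ?_⟩
  have hmem : g ^ n ∈ Set.range (fun k : Fin p => g ^ (k : ℕ)) :=
    ⟨⟨n % p, Nat.mod_lt _ hp⟩, by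
      conv_rhs => rw [← Nat.mod_add_div n p, pow_add, pow_mul, hgp, one_pow, mul_one]⟩
  have : g ^ n = g ^ (-(j : ℤ)) := by
    by_contra h
    exact hn ⟨hmem, h⟩
  rw [pow_add, this, zpow_neg, zpow_natCast, inv_mul_cancel]

theorem IsFHypercyclicVector.pow {F : Set (Set ℕ)} (hF : IsFurstenbergFamily F)
    (hcusp : HasCuSP F) {p : ℕ} (hp : 1 ≤ p)
    (hpF : ∀ A : Set ℕ, A ∈ F ↔ (fun n => p * n) '' A ∈ F) {T : X →L[𝕜] X} {x : X}
    (hx : IsFHypercyclicVector F T x) : IsFHypercyclicVector F (T ^ p) x := by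
  intro U hU hne
  have hd := hx.denseRange hF
  choose n hnU hn using fun j : Fin p => exists_pow_mem_and_dvd_add hd hp j hU hne
  have : Nonempty (Fin p) := ⟨⟨0, hp⟩⟩
  -- A single open neighbourhood of `x` serves all residue classes, so CuSP is applied to one return
  -- set.
  have hA := hx (⋂ j, (T ^ n j) ⁻¹' U) (isOpen_iInter_of_finite fun j =>
    hU.preimage (T ^ n j).continuous) ⟨x, Set.mem_iInter.2 hnU⟩
  have hB := hcusp.iUnion_mem (fun j : Fin p => {k | k % p = j}) n
    (Set.eq_univ_of_forall fun k => Set.mem_iUnion.2 ⟨⟨k % p, Nat.mod_lt _ hp⟩, rfl⟩) hA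
  refine (hpF _).2 (hF.mono _ hB _ ?_)
  rintro _ hm
  obtain ⟨j, k, ⟨hkA, hkj⟩, rfl⟩ := Set.mem_iUnion.1 hm
  have hkj' : k % p = j := hkj
  obtain ⟨q, hq⟩ : p ∣ n j + k := by
    rw [← Nat.mod_add_div k p, ← add_assoc, hkj']
    exact dvd_add (hn j) (dvd_mul_right _ _)
  refine ⟨q, ?_, hq.symm⟩
  change ((T ^ p) ^ q) x ∈ U
  rw [← pow_mul, ← hq, pow_add, mul_apply_eq_comp]
  exact Set.mem_iInter.1 hkA j

/-- Rotated visits of a dense orbit to an open set. -/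
theorem exists_pow_smul_mem {T : X →L[𝕜] X} {x : X}
    (hx : DenseRange fun n : ℕ => (T ^ n) x) {c : 𝕜} (hc : ‖c‖ = 1) {μ : 𝕜} (hμ : μ ≠ 0)
    {U : Set X} (hU : IsOpen U) (hne : U.Nonempty) :
    ∃ n : ℕ, (μ * c ^ n) • (T ^ n) x ∈ U := by
  obtain ⟨u, hu⟩ := hne
  obtain ⟨g, hg⟩ := exists_circle_map_pow_eq hc
  have hcont : Continuous fun q : X × Circle => (μ * RCLike.map ℂ 𝕜 (q.2 : ℂ)) • q.1 := by fun_prop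
  -- At `(μ⁻¹ • u, 1)` this map takes the value `u ∈ U`; it remains to visit `μ⁻¹ • u` while `g ^ n`
  -- is near `1 = g ^ 0`.
  have hnhds : (fun q : X × Circle => (μ * RCLike.map ℂ 𝕜 (q.2 : ℂ)) • q.1) ⁻¹' U ∈
      𝓝 (μ⁻¹ • u, (1 : Circle)) := by
    refine (hU.preimage hcont).mem_nhds ?_
    have h1 : RCLike.map ℂ 𝕜 ((1 : Circle) : ℂ) = 1 := by simp
    simpa [h1, hμ] using hu
  obtain ⟨V, W, hV, hVu, hW, hW1, hVW⟩ := mem_nhds_prod_iff'.1 hnhds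
  obtain ⟨n, hnV, hnW⟩ := exists_pow_mem_and_circle_pow_mem hx g 0 hV ⟨_, hVu⟩
    (by simpa using hW.mem_nhds hW1)
  have : (μ * RCLike.map ℂ 𝕜 ((g ^ n : Circle) : ℂ)) • (T ^ n) x ∈ U :=
    hVW (Set.mk_mem_prod hnV hnW)
  exact ⟨n, by rwa [hg] at this⟩

theorem IsFHypercyclicVector.smul {F : Set (Set ℕ)} (hF : IsFurstenbergFamily F)
    (hcusp : HasCuSP F) {c : 𝕜} (hc : ‖c‖ = 1) {T : X →L[𝕜] X} {x : X}
    (hx : IsFHypercyclicVector F T x) : IsFHypercyclicVector F (c • T) x := by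
  intro U hU hne
  have hd := hx.denseRange hF
  have hex : ∀ μ ∈ Metric.sphere (0 : 𝕜) 1, ∃ n : ℕ, ∃ V : Set X, ∃ W : Set 𝕜,
      IsOpen V ∧ x ∈ V ∧ W ∈ 𝓝 μ ∧
        ∀ v ∈ V, ∀ w ∈ W, (w * c ^ n) • (T ^ n) v ∈ U := by
    intro μ hμ
    obtain ⟨n, hn⟩ := exists_pow_smul_mem hd hc (ne_zero_of_mem_unit_sphere ⟨μ, hμ⟩) hU hne
    have hcont : Continuous fun q : X × 𝕜 => (q.2 * c ^ n) • (T ^ n) q.1 := by fun_prop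
    obtain ⟨V, W, hV, hxV, hW, hμW, hVW⟩ :=
      mem_nhds_prod_iff'.1 ((hU.preimage hcont).mem_nhds (show (x, μ) ∈ _ from hn))
    exact ⟨n, V, W, hV, hxV, hW.mem_nhds hμW, fun v hv w hw => hVW (Set.mk_mem_prod hv hw)⟩
  -- The shift `n μ` works uniformly for `v` near `x` and scalars near `μ`, so a finite subcover of
  -- the sphere gives the pieces for CuSP.
  choose! n V W hV hxV hW hVW using hex
  obtain ⟨t, ht, hcov⟩ := (isCompact_sphere (0 : 𝕜) 1).elim_nhds_subcover W hW
  have hcn : ∀ k : ℕ, ∃ μ : t, c ^ k ∈ W μ := by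
    intro k
    obtain ⟨μ, hμ, h⟩ := Set.mem_iUnion₂.1 (hcov (show c ^ k ∈ Metric.sphere (0 : 𝕜) 1 by simp [hc]))
    exact ⟨⟨μ, hμ⟩, h⟩
  have : Nonempty t := ⟨(hcn 0).choose⟩
  have hA := hx (⋂ μ : t, V μ) (isOpen_iInter_of_finite fun μ => hV μ (ht μ μ.2))
    ⟨x, Set.mem_iInter.2 fun μ => hxV μ (ht μ μ.2)⟩
  have hB := hcusp.iUnion_mem (fun μ : t => {k | c ^ k ∈ W μ}) (fun μ => n μ)
    (Set.eq_univ_of_forall fun k => Set.mem_iUnion.2 (hcn k)) hA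
  refine hF.mono _ hB _ ?_
  rintro _ hm
  obtain ⟨μ, k, ⟨hkA, hkμ⟩, rfl⟩ := Set.mem_iUnion.1 hm
  change ((c • T) ^ (n μ + k)) x ∈ U
  rw [_root_.smul_pow, pow_add, mul_comm, pow_add T]
  exact hVW μ (ht μ μ.2) _ (Set.mem_iInter.1 hkA μ) _ hkμ

end Hypercyclic
end FHyp

theorem theorem8p6 {𝕜 X : Type*} [RCLike 𝕜] [AddCommGroup X] [Module 𝕜 X] [TopologicalSpace X]
    [IsTopologicalAddGroup X] [ContinuousSMul 𝕜 X] (T : X →L[𝕜] X)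
    (F : Set (Set ℕ)) (hF : FHyp.IsFurstenbergFamily F) (hright : FHyp.IsRightInvariant F)
    (hcusp : FHyp.HasCuSP F) :
    (∀ p : ℕ, 1 ≤ p → (∀ A : Set ℕ, A ∈ F ↔ (fun n => p * n) '' A ∈ F) →
      {x : X | FHyp.IsFHypercyclicVector F T x} =
          {x : X | FHyp.IsFHypercyclicVector F (T ^ p) x} ∧
        (FHyp.IsFHypercyclic F T → FHyp.IsFHypercyclic F (T ^ p))) ∧
    (∀ c : 𝕜, ‖c‖ = 1 →
      {x : X | FHyp.IsFHypercyclicVector F T x} =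
          {x : X | FHyp.IsFHypercyclicVector F (c • T) x} ∧
        (FHyp.IsFHypercyclic F T → FHyp.IsFHypercyclic F (c • T))) := by
  constructor
  · intro p hp hpF
    exact ⟨Set.ext fun x => ⟨fun hx => FHyp.IsFHypercyclicVector.pow hF hcusp hp hpF hx,
      fun hx => FHyp.IsFHypercyclicVector.of_pow hF hpF hx⟩,
      fun ⟨x, hx⟩ => ⟨x, FHyp.IsFHypercyclicVector.pow hF hcusp hp hpF hx⟩⟩
  · intro c hc
    have hc0 : c ≠ 0 := by
      rintro rfl
      simp at hc
    refine ⟨Set.ext fun x => ⟨fun hx => FHyp.IsFHypercyclicVector.smul hF hcusp hc hx,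
      fun hx => ?_⟩, fun ⟨x, hx⟩ => ⟨x, FHyp.IsFHypercyclicVector.smul hF hcusp hc hx⟩⟩
    -- The converse is the same implication for `c • T` and the unimodular scalar `c⁻¹`.
    have := FHyp.IsFHypercyclicVector.smul hF hcusp (c := c⁻¹) (by simp [hc]) hx
    rwa [smul_smul, inv_mul_cancel₀ hc0, one_smul] at this
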